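/- Let $R$ be an integral domain with field of fractions $K$, and let $A$ be a cellular $R$-algebra in the sense of Graham and Lehrer, with cell datum $(\Lambda, M, C, i)$ and cellular basis $\{C_{S,T}^\lambda \mid \lambda\in\Lambda,\ S,T\in M(\lambda)\}$, where $\Lambda$ is a finite poset and the $M(\lambda)$ are finite non-empty sets. Let $\tau : A \to R$ be a symmetrizing trace, that is, $\tau(a) = f(a,1)$ for a non-degenerate (Gram determinant in a basis a unit of $R$) associative symmetric $R$-bilinear form $f$ on $A$. Let $\{D_{S,T}^\lambda\}$ be the dual basis, determined by $\tau(C_{S,T}^\lambda D_{U,V}^\mu) = 1$ if $(\lambda,S,T) = (\mu,U,V)$ and $0$ otherwise. For $\lambda\in\Lambda$ and any chosen $T\in M(\lambda)$ put $$x_\lambda = \sum_{S\in M(\lambda)} C_{S,T}^\lambda D_{S,T}^\lambda .$$ Assume that $A_K = K\otimes_R A$ is split semisimple, regard $A$ as a subring of $A_K$, and extend $\tau$ to $A_K$. Let $W(\lambda)$ be the cell module with $R$-basis $\{C_S \mid S\in M(\lambda)\}$ and action $aC_S = \sum_{S'} r_a(S',S)C_{S'}$, where $aC_{S,T}^\lambda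 \equiv \sum_{S'} r_a(S',S) C_{S',T}^\lambda$ modulo the $R$-span of the $C_{U,V}^\mu$ with $\mu<\lambda$. Let $c_{W(\lambda)}\in K$ be the Schur element of the $A_K$-module $W(\lambda)_K = K\otimes_R W(\lambda)$, i.e. the unique element with $$\sum_{\mu\in\Lambda,\ U,V\in M(\mu)} C_{U,V}^\mu\,\varphi\bigl(D_{U,V}^\mu v\bigr) = c_{W(\lambda)}\,\mathrm{tr}(\varphi)\,v \qquad\text{for all } \varphi\in \mathrm{End}_K(W(\lambda)_K),\ v\in W(\lambda)_K$$ (in particular such an element exists). If $a_\lambda\in K$ for all $\lambda\in\Lambda$ and $a = \sum_{\lambda\in\Lambda} a_\lambda x_\lambda$ lies in $A$, then $a_\lambda\, c_{W(\lambda)}\, n_\lambda \in R$ for every $\lambda\in\Lambda$, where $n_\lambda = |M(\lambda)|$. -/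

import Mathlib

open scoped TensorProduct

universe v w

/-! ### Symmetric algebras -/

section Symmetric

variable {R A : Type*} [CommRing R] [Ring A] [Algebra R A]

/-- `τ` is a symmetrizing trace on the `R`-algebra `A`: there is a non-degenerate associative
symmetric `R`-bilinear form `f` on the finitely generated free `R`-module `A` with
`τ a = f a 1`. Non-degenerate means that the Gram matrix in some `R`-basis has unit determinant. -/
def IsSymmetrizingTrace (τ : A →ₗ[R] R) : Prop :=
  ∃ f : A →ₗ[R] A →ₗ[R] R,
    (∀ a b c : A, f (a * b) c = f a (b * c)) ∧
    (∀ a b : A, f a b = f b a) ∧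
    (∃ (n : ℕ) (b : Module.Basis (Fin n) R A),
      IsUnit (Matrix.of fun j k : Fin n => f (b j) (b k)).det) ∧
    ∀ a : A, τ a = f a 1

/-- The Gram matrix `(τ (b j * b k))` of a basis. -/
noncomputable def traceGram {ι : Type*} (τ : A →ₗ[R] R) (b : Module.Basis ι R A) : Matrix ι ι R :=
  Matrix.of fun j k => τ (b j * b k)

open Classical in
/-- The dual basis of `b` with respect to `τ`, characterised (when `τ` is a symmetrizing trace) by
`τ (b j * dualBasis τ b k) = δ_{jk}`; it is written out through the inverse Gram matrix. -/
noncomputable def traceDualBasis {ι : Type*} [Fintype ι] (τ : A →ₗ[R] R)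
    (b : Module.Basis ι R A) (k : ι) : A :=
  ∑ l, (traceGram τ b)⁻¹ l k • b l

open Classical in
theorem IsSymmetrizingTrace.isUnit_traceGram {ι : Type*} [Fintype ι] {τ : A →ₗ[R] R}
    (hτ : IsSymmetrizingTrace τ) (b : Module.Basis ι R A) : IsUnit (traceGram τ b).det := by
  obtain ⟨f, hassoc, -, ⟨n, b', hdet⟩, hτf⟩ := hτ
  have hf : ∀ x y, f x y = τ (x * y) := by
    intro x y
    rw [hτf, hassoc, mul_one]
  have h1 : (LinearMap.toMatrix₂ b' b' f) = Matrix.of fun j k : Fin n => f (b' j) (b' k) := by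
    ext j k
    simp [LinearMap.toMatrix₂_apply]
  have h2 : (LinearMap.toMatrix₂ b b f) = traceGram τ b := by
    ext j k
    simp [LinearMap.toMatrix₂_apply, traceGram, hf]
  rcases subsingleton_or_nontrivial R with hR | hR
  · exact isUnit_of_subsingleton _
  have e : Fin n ≃ ι := b'.indexEquiv b
  have h3 : LinearMap.toMatrix₂ (b.reindex e.symm) (b.reindex e.symm) f
      = (traceGram τ b).submatrix e e := by
    ext j k
    simp [LinearMap.toMatrix₂_apply, traceGram, hf]
  have h4 := LinearMap.toMatrix₂_mul_basis_toMatrix (b.reindex e.symm) (b.reindex e.symm) b' b' f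
  rw [h1] at h4
  have h5 := congrArg Matrix.det h4
  rw [Matrix.det_mul, Matrix.det_mul] at h5
  rw [← h5, h3, Matrix.det_submatrix_equiv_self] at hdet
  exact isUnit_of_mul_isUnit_right (isUnit_of_mul_isUnit_left hdet)

open Classical in
theorem IsSymmetrizingTrace.trace_mul_dual {ι : Type*} [Fintype ι] {τ : A →ₗ[R] R}
    (hτ : IsSymmetrizingTrace τ) (b : Module.Basis ι R A) (j k : ι) :
    τ (b j * traceDualBasis τ b k) = if j = k then 1 else 0 := by
  have h := Matrix.mul_nonsing_inv _ (hτ.isUnit_traceGram b)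
  have h' := congrFun (congrFun h j) k
  rw [Matrix.mul_apply, Matrix.one_apply] at h'
  rw [← h', traceDualBasis, Finset.mul_sum, map_sum]
  refine Finset.sum_congr rfl fun l _ => ?_
  rw [mul_smul_comm, map_smul, smul_eq_mul, mul_comm]
  rfl

end Symmetric

/-! ### Cellular algebras -/

section Cellular

/-- A cell datum `(Λ, M, C, i)` on the `R`-algebra `A` in the sense of Graham and Lehrer. The
basis element `C_{S,T}^λ` is `basis ⟨λ, S, T⟩`. The coefficients `coeff a S' S = r_a(S', S)` do not
depend on `T`; they are determined by the other data, since the `C_{S',T}^λ` are linearly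
independent modulo `A(< λ)`. -/
structure CellDatum (R A : Type*) [CommRing R] [Ring A] [Algebra R A]
    (Λ : Type*) [PartialOrder Λ] (M : Λ → Type*) [∀ l, Fintype (M l)] where
  basis : Module.Basis (Σ l : Λ, M l × M l) R A
  inv : A →ₗ[R] A
  inv_mul : ∀ a b : A, inv (a * b) = inv b * inv a
  inv_inv : ∀ a : A, inv (inv a) = a
  inv_basis : ∀ (l : Λ) (S T : M l), inv (basis ⟨l, S, T⟩) = basis ⟨l, T, S⟩
  coeff : A → ∀ l : Λ, M l → M l → R
  mul_basis : ∀ (l : Λ) (S T : M l) (a : A),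
    a * basis ⟨l, S, T⟩ - ∑ S', coeff a l S' S • basis ⟨l, S', T⟩ ∈
      Submodule.span R {x : A | ∃ (m : Λ) (_ : m < l) (U V : M m), x = basis ⟨m, U, V⟩}

namespace CellDatum

variable {R A : Type*} [CommRing R] [Ring A] [Algebra R A]
  {Λ : Type*} [PartialOrder Λ] {M : Λ → Type*} [∀ l, Fintype (M l)]

/-- The submodule `A(< λ)`. -/
def lower (D : CellDatum R A Λ M) (l : Λ) : Submodule R A :=
  Submodule.span R {x : A | ∃ (m : Λ) (_ : m < l) (U V : M m), x = D.basis ⟨m, U, V⟩}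

theorem repr_lower (D : CellDatum R A Λ M) (l : Λ) (S T : M l) {x : A} (hx : x ∈ D.lower l) :
    D.basis.repr x ⟨l, S, T⟩ = 0 := by
  classical
  refine Submodule.span_induction (p := fun x _ => D.basis.repr x ⟨l, S, T⟩ = 0)
    ?_ ?_ ?_ ?_ hx
  · rintro x ⟨m, hm, U, V, rfl⟩
    rw [Module.Basis.repr_self, Finsupp.single_apply, if_neg]
    intro h
    exact hm.ne (congrArg Sigma.fst h)
  · simp
  · intro x y _ _ hx hy
    simp [hx, hy]
  · intro a x _ hx
    simp [hx]

theorem lower_mono (D : CellDatum R A Λ M) {l m : Λ} (h : m < l) : D.lower m ≤ D.lower l := by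
  refine Submodule.span_mono ?_
  rintro x ⟨k, hk, U, V, rfl⟩
  exact ⟨k, hk.trans h, U, V, rfl⟩

theorem mul_mem_lower (D : CellDatum R A Λ M) (l : Λ) (a : A) {x : A} (hx : x ∈ D.lower l) :
    a * x ∈ D.lower l := by
  refine Submodule.span_induction (p := fun x _ => a * x ∈ D.lower l) ?_ ?_ ?_ ?_ hx
  · rintro x ⟨m, hm, U, V, rfl⟩
    have h := D.lower_mono hm (D.mul_basis m U V a)
    have h2 : ∑ S', D.coeff a m S' U • D.basis ⟨m, S', V⟩ ∈ D.lower l :=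
      Submodule.sum_mem _ fun S' _ =>
        Submodule.smul_mem _ _ (Submodule.subset_span ⟨m, hm, S', V, rfl⟩)
    simpa using Submodule.add_mem _ h h2
  · simp
  · intro x y _ _ hx hy
    rw [mul_add]
    exact Submodule.add_mem _ hx hy
  · intro r x _ hx
    rw [mul_smul_comm]
    exact Submodule.smul_mem _ _ hx

theorem repr_mul_basis (D : CellDatum R A Λ M) (l : Λ) (S' S T : M l) (a : A) :
    D.basis.repr (a * D.basis ⟨l, S, T⟩) ⟨l, S', T⟩ = D.coeff a l S' S := by
  classical
  have h := D.repr_lower l S' T (D.mul_basis l S T a)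
  rw [map_sub, Finsupp.sub_apply, sub_eq_zero] at h
  rw [h, map_sum, Finsupp.finsetSum_apply]
  rw [Finset.sum_eq_single S']
  · simp
  · intro U _ hU
    simp [hU]
  · simp

theorem coeff_add (D : CellDatum R A Λ M) (l : Λ) (S' S : M l) (a b : A) :
    D.coeff (a + b) l S' S = D.coeff a l S' S + D.coeff b l S' S := by
  simp only [← D.repr_mul_basis l S' S S, add_mul, map_add, Finsupp.add_apply]

theorem coeff_smul (D : CellDatum R A Λ M) (l : Λ) (S' S : M l) (r : R) (a : A) :
    D.coeff (r • a) l S' S = r * D.coeff a l S' S := by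
  simp only [← D.repr_mul_basis l S' S S, smul_mul_assoc, map_smul, Finsupp.smul_apply,
    smul_eq_mul]

open Classical in
theorem coeff_one (D : CellDatum R A Λ M) (l : Λ) (S' S : M l) :
    D.coeff 1 l S' S = if S' = S then 1 else 0 := by
  rw [← D.repr_mul_basis l S' S S, one_mul, Module.Basis.repr_self, Finsupp.single_apply]
  by_cases h : S' = S
  · simp [h]
  · rw [if_neg h, if_neg]
    intro h'
    simp at h'
    exact h h'.symm

theorem coeff_mul (D : CellDatum R A Λ M) (l : Λ) (S' S : M l) (a b : A) :
    D.coeff (a * b) l S' S = ∑ U, D.coeff a l S' U * D.coeff b l U S := by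
  have h := D.repr_lower l S' S (D.mul_mem_lower l a (D.mul_basis l S S b))
  rw [mul_sub, map_sub, Finsupp.sub_apply, sub_eq_zero, ← mul_assoc, D.repr_mul_basis] at h
  rw [h, Finset.mul_sum, map_sum, Finsupp.finsetSum_apply]
  refine Finset.sum_congr rfl fun U _ => ?_
  rw [mul_smul_comm, map_smul, Finsupp.smul_apply, D.repr_mul_basis, smul_eq_mul, mul_comm]

open Classical in
/-- The cell module `W(λ)`: the free `R`-module `M(λ) → R` with basis `C_S = Pi.single S 1`, on
which `a` acts by `a C_S = ∑ S', r_a(S', S) C_{S'}`, given as the representation it affords. -/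
noncomputable def cellRep (D : CellDatum R A Λ M) (l : Λ) :
    A →ₐ[R] Module.End R (M l → R) :=
  (Matrix.toLinAlgEquiv' : Matrix (M l) (M l) R ≃ₐ[R] _).toAlgHom.comp <|
    AlgHom.ofLinearMap
      { toFun := fun a => Matrix.of fun S' S => D.coeff a l S' S
        map_add' := fun a b => by
          ext S' S
          simp [D.coeff_add]
        map_smul' := fun r a => by
          ext S' S
          simp [D.coeff_smul] }
      (by
        ext S' S
        simp [D.coeff_one, Matrix.one_apply])
      (fun a b => by
        ext S' S
        simp [D.coeff_mul, Matrix.mul_apply])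

open Classical in
theorem cellRep_single (D : CellDatum R A Λ M) (l : Λ) (a : A) (S : M l) :
    D.cellRep l a (Pi.single S 1) = ∑ S', D.coeff a l S' S • Pi.single S' (1 : R) := by
  ext U
  change Matrix.toLin' (Matrix.of fun S' S => D.coeff a l S' S) (Pi.single S 1) U = _
  rw [Matrix.toLin'_apply, Matrix.mulVec_single_one]
  simp [Matrix.col, Pi.single_apply]

/-- The element `x_λ = ∑ S, C_{S,T}^λ D_{S,T}^λ`, formed with a given `T ∈ M(λ)`. -/
noncomputable def xElem [Fintype Λ] (D : CellDatum R A Λ M) (τ : A →ₗ[R] R) (l : Λ) (T : M l) : A :=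
  ∑ S, D.basis ⟨l, S, T⟩ * traceDualBasis τ D.basis ⟨l, S, T⟩

end CellDatum

end Cellular

/-! ### Extension of scalars -/

section BaseChange

variable (K : Type*) {R A W : Type*} [CommRing R] [CommRing K] [Algebra R K] [Ring A] [Algebra R A]
  [AddCommGroup W] [Module R W]

/-- The `K`-linear extension of `τ` to `A_K = K ⊗ A`. -/
noncomputable def traceBaseChange (τ : A →ₗ[R] R) : (K ⊗[R] A) →ₗ[K] K :=
  (TensorProduct.AlgebraTensorModule.rid R K K).toLinearMap ∘ₗ τ.baseChange K

/-- The extension of a representation of `A` on `W` to one of `A_K = K ⊗ A` on `K ⊗ W`. -/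
noncomputable def repBaseChange (ρ : A →ₐ[R] Module.End R W) :
    (K ⊗[R] A) →ₐ[K] Module.End K (K ⊗[R] W) :=
  Algebra.TensorProduct.lift (Algebra.ofId K _) ((Module.End.baseChangeHom R K W).comp ρ)
    fun k _ => by
      rw [Algebra.ofId_apply]
      exact Algebra.commute_algebraMap_left k _

theorem traceBaseChange_tmul (τ : A →ₗ[R] R) (k : K) (a : A) :
    traceBaseChange K τ (k ⊗ₜ a) = k * algebraMap R K (τ a) := by
  simp [traceBaseChange, Algebra.smul_def, mul_comm]

theorem repBaseChange_tmul (ρ : A →ₐ[R] Module.End R W) (k k' : K) (a : A) (w : W) :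
    repBaseChange K ρ (k ⊗ₜ a) (k' ⊗ₜ w) = (k * k') ⊗ₜ ρ a w := by
  rw [repBaseChange, Algebra.TensorProduct.lift_tmul, Module.End.mul_apply, Algebra.ofId_apply,
    Module.algebraMap_end_apply]
  change k • (k' ⊗ₜ[R] (ρ a w)) = _
  rw [TensorProduct.smul_tmul', smul_eq_mul]

end BaseChange

/-! ### Schur elements and split semisimple algebras -/

section Schur

variable {K B V ι : Type*} [Field K] [Ring B] [Algebra K B] [AddCommGroup V] [Module K V]
  [Fintype ι]

/-- `c` is the Schur element of the representation `ρ` with respect to the trace form `τ`: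
`∑ j, ρ(b_j) φ ρ(b_j^∨) = c tr(φ) id_V` for all `K`-linear `φ : V → V`. (This pins `c` also when
`dim V` vanishes in `K`; it implies `∑ j, χ(b_j) χ(b_j^∨) = c dim V`, as proved below.) -/
def IsSchurElement (τ : B →ₗ[K] K) (b : Module.Basis ι K B) (ρ : B →ₐ[K] Module.End K V)
    (c : K) : Prop :=
  ∀ φ : Module.End K V,
    ∑ j, ρ (b j) * φ * ρ (traceDualBasis τ b j) = (c * LinearMap.trace K V φ) • (1 : Module.End K V)

open Classical in
/-- The Schur element `c_V` of a representation (`0` if there is none). -/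
noncomputable def schurElement (τ : B →ₗ[K] K) (b : Module.Basis ι K B)
    (ρ : B →ₐ[K] Module.End K V) : K :=
  if h : ∃ c, IsSchurElement τ b ρ c then h.choose else 0

theorem IsSchurElement.sum_char_mul_char [FiniteDimensional K V] {τ : B →ₗ[K] K}
    {b : Module.Basis ι K B} {ρ : B →ₐ[K] Module.End K V} {c : K} (h : IsSchurElement τ b ρ c) :
    ∑ j, LinearMap.trace K V (ρ (b j)) * LinearMap.trace K V (ρ (traceDualBasis τ b j)) =
      c * Module.finrank K V := by
  let e := Module.finBasis K V
  have htr : ∀ f : Module.End K V, LinearMap.trace K V f = ∑ p, e.coord p (f (e p)) := by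
    intro f
    rw [LinearMap.trace_eq_matrix_trace K e, Matrix.trace]
    simp [LinearMap.toMatrix_apply]
  have key : ∀ p q, ∑ j, e.coord p (ρ (b j) (e p)) *
      e.coord q (ρ (traceDualBasis τ b j) (e q)) = if p = q then c else 0 := by
    intro p q
    have h1 := congrArg (fun g : Module.End K V => e.coord p (g (e q)))
      (h ((e.coord q).smulRight (e p)))
    have h2 : LinearMap.trace K V ((e.coord q).smulRight (e p)) = if p = q then 1 else 0 := by
      rw [htr, Finset.sum_eq_single q]
      · simp [Finsupp.single_apply]
      · intro x _ hx
        simp [hx]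
      · simp
    rw [h2] at h1
    simp [LinearMap.sum_apply] at h1
    simp only [Module.Basis.coord_apply]
    rw [Finset.sum_congr rfl fun j _ => mul_comm _ _, h1]
    by_cases hpq : p = q <;> simp [hpq]
  simp only [htr, Finset.sum_mul_sum]
  rw [Finset.sum_comm]
  rw [Finset.sum_congr rfl fun p _ => Finset.sum_comm]
  simp only [key]
  simp [mul_comm]

theorem IsSchurElement.eq [FiniteDimensional K V] [Nontrivial V] {τ : B →ₗ[K] K}
    {b : Module.Basis ι K B} {ρ : B →ₐ[K] Module.End K V} {c c' : K}
    (h : IsSchurElement τ b ρ c) (h' : IsSchurElement τ b ρ c') : c = c' := by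
  let e := Module.finBasis K V
  let p : Fin (Module.finrank K V) := ⟨0, Module.finrank_pos⟩
  have h2 : LinearMap.trace K V ((e.coord p).smulRight (e p)) = 1 := by
    rw [LinearMap.trace_eq_matrix_trace K e, Matrix.trace, Finset.sum_eq_single p]
    · rw [Matrix.diag_apply, LinearMap.toMatrix_apply]
      simp
    · intro x _ hx
      rw [Matrix.diag_apply, LinearMap.toMatrix_apply]
      simp [hx]
    · simp
  have h3 := (h ((e.coord p).smulRight (e p))).symm.trans (h' ((e.coord p).smulRight (e p)))
  rw [h2, mul_one, mul_one] at h3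
  exact smul_left_injective K (one_ne_zero : (1 : Module.End K V) ≠ 0) h3

theorem IsSchurElement.schurElement_eq [FiniteDimensional K V] [Nontrivial V] {τ : B →ₗ[K] K}
    {b : Module.Basis ι K B} {ρ : B →ₐ[K] Module.End K V} {c : K}
    (h : IsSchurElement τ b ρ c) : schurElement τ b ρ = c := by
  have hex : ∃ c, IsSchurElement τ b ρ c := ⟨c, h⟩
  rw [schurElement, dif_pos hex]
  exact hex.choose_spec.eq h

/-- A finite-dimensional `K`-algebra `B` is split semisimple: it is semisimple, and every
endomorphism of every simple `B`-module is multiplication by a scalar from `K`. -/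
def IsSplitSemisimple (K : Type w) (B : Type v) [Field K] [Ring B] [Algebra K B] : Prop :=
  IsSemisimpleRing B ∧
    ∀ (V : Type v) [AddCommGroup V] [Module B V], IsSimpleModule B V →
      ∀ f : V →ₗ[B] V, ∃ c : K, ∀ v, f v = algebraMap K B c • v

end Schur

/-! ### The setting of a symmetric cellular algebra over a domain with fraction field `K` -/

section CellSchur

variable (K : Type*) {R A Λ : Type*} [CommRing R] [Field K] [Algebra R K] [Ring A] [Algebra R A]
  [PartialOrder Λ] [Fintype Λ] {M : Λ → Type*} [∀ l, Fintype (M l)]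

/-- `c` is the Schur element of the cell module `K ⊗ W(λ)` of `A_K = K ⊗ A`, with respect to the
extension of `τ` to `A_K`. -/
def CellDatum.IsCellSchurElement (D : CellDatum R A Λ M) (τ : A →ₗ[R] R) (l : Λ) (c : K) : Prop :=
  IsSchurElement (traceBaseChange K τ) (D.basis.baseChange K) (repBaseChange K (D.cellRep l)) c

/-- The Schur element `c_{W(λ)}` of the cell module `K ⊗ W(λ)` of `A_K = K ⊗ A`, with respect to
the extension of `τ` to `A_K`. -/
noncomputable def CellDatum.cellSchurElement (D : CellDatum R A Λ M) (τ : A →ₗ[R] R) (l : Λ) : K :=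
  schurElement (traceBaseChange K τ) (D.basis.baseChange K) (repBaseChange K (D.cellRep l))

end CellSchur

/-! ### Symmetrizing traces and dual bases. -/

section SymmetrizingTrace

variable {R A : Type*} [CommRing R] [Ring A] [Algebra R A] {τ : A →ₗ[R] R}

/-! Apply the character of `W(l)` to `a`: its value lies in `R`, because the cell module is defined
over `R`. It kills `x_m` for `m ≠ l` and takes the value `c_{W(l)} n_l` on `x_l`, so `χ_l(a) = α_l
c_{W(l)} n_l`.

Both evaluations rest on `coeff_eq_trace`, which writes every matrix coefficient of a cell module as
`τ` paired with an element `C_{S,T} D_{S',T}`. Traces of products of two such elements are then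
computed by cellularity and the symmetry of `τ` (`trace_cross_of_ne`, `trace_cross_self`): they
vanish or equal one scalar `cellScalar`. The Casimir identity turns this into Schur orthogonality
for the cell module, which identifies that scalar with the Schur element
(`isCellSchurElement_cellScalar`). -/

theorem IsSymmetrizingTrace.trace_mul_comm (hτ : IsSymmetrizingTrace τ) (a b : A) :
    τ (a * b) = τ (b * a) := by
  obtain ⟨f, hassoc, hsymm, -, hτf⟩ := hτ
  rw [hτf, hτf, hassoc, hassoc, mul_one, mul_one, hsymm]

variable {ι : Type*} [Fintype ι]

theorem IsSymmetrizingTrace.trace_mul_dualBasis (hτ : IsSymmetrizingTrace τ)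
    (b : Module.Basis ι R A) (a : A) (j : ι) : τ (a * traceDualBasis τ b j) = b.repr a j := by
  classical
  conv_lhs => rw [← b.sum_repr a]
  simp only [Finset.sum_mul, map_sum, smul_mul_assoc, map_smul, hτ.trace_mul_dual]
  simp

/-- The Casimir identity `∑ j, τ (b_j x) τ (b_j^∨ y) = τ (x y)`. -/
theorem IsSymmetrizingTrace.sum_trace_mul_trace (hτ : IsSymmetrizingTrace τ)
    (b : Module.Basis ι R A) (x y : A) :
    ∑ j, τ (b j * x) * τ (traceDualBasis τ b j * y) = τ (x * y) := by
  rw [hτ.trace_mul_comm x y]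
  conv_rhs => rw [← b.sum_repr y]
  simp only [Finset.sum_mul, map_sum, smul_mul_assoc, map_smul, smul_eq_mul]
  refine Finset.sum_congr rfl fun j _ => ?_
  rw [hτ.trace_mul_comm (traceDualBasis τ b j), hτ.trace_mul_dualBasis, mul_comm]

/-- The Gram matrix is already invertible over `R`, so its inverse is preserved by the ring map to
`K`. -/
theorem IsSymmetrizingTrace.traceDualBasis_baseChange (hτ : IsSymmetrizingTrace τ)
    (K : Type*) [CommRing K] [Algebra R K] (b : Module.Basis ι R A) (j : ι) :
    traceDualBasis (traceBaseChange K τ) (b.baseChange K) j = 1 ⊗ₜ[R] traceDualBasis τ b j := by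
  classical
  have hG : traceGram (traceBaseChange K τ) (b.baseChange K)
      = (traceGram τ b).map (algebraMap R K) := by
    ext i k
    simp [traceGram, traceBaseChange_tmul]
  have hI : (traceGram (traceBaseChange K τ) (b.baseChange K))⁻¹
      = (traceGram τ b)⁻¹.map (algebraMap R K) := by
    refine Matrix.inv_eq_right_inv ?_
    rw [hG, ← Matrix.map_mul, Matrix.mul_nonsing_inv _ (hτ.isUnit_traceGram b),
      Matrix.map_one _ (map_zero _) (map_one _)]
  simp only [traceDualBasis, TensorProduct.tmul_sum]
  refine Finset.sum_congr rfl fun i _ => ?_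
  rw [hI, Matrix.map_apply, Module.Basis.baseChange_apply, TensorProduct.tmul_smul, algebraMap_smul]

end SymmetrizingTrace

/-! ### Action of the cellular basis on cell modules. -/

namespace CellDatum

variable {R A : Type*} [CommRing R] [Ring A] [Algebra R A]
  {Λ : Type*} [PartialOrder Λ] {M : Λ → Type*} [∀ l, Fintype (M l)]

theorem inv_mem_lower (D : CellDatum R A Λ M) (l : Λ) {x : A} (hx : x ∈ D.lower l) :
    D.inv x ∈ D.lower l := by
  refine Submodule.span_induction (p := fun x _ => D.inv x ∈ D.lower l) ?_ ?_ ?_ ?_ hx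
  · rintro x ⟨m, hm, U, V, rfl⟩
    rw [D.inv_basis]
    exact Submodule.subset_span ⟨m, hm, V, U, rfl⟩
  · simp
  · intro x y _ _ hx hy
    rw [map_add]
    exact Submodule.add_mem _ hx hy
  · intro r x _ hx
    rw [map_smul]
    exact Submodule.smul_mem _ _ hx

/-- The anti-involution turns the left multiplication rule into a right one. -/
theorem basis_mul (D : CellDatum R A Λ M) (l : Λ) (U V : M l) (a : A) :
    D.basis ⟨l, U, V⟩ * a - ∑ V', D.coeff (D.inv a) l V' V • D.basis ⟨l, U, V'⟩ ∈ D.lower l := by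
  have h := D.inv_mem_lower l (D.mul_basis l V U (D.inv a))
  simpa only [map_sub, D.inv_mul, D.inv_inv, D.inv_basis, map_sum, map_smul] using h

theorem repr_lower_of_not_lt (D : CellDatum R A Λ M) {l m : Λ} (h : ¬ m < l) (S T : M m) {x : A}
    (hx : x ∈ D.lower l) : D.basis.repr x ⟨m, S, T⟩ = 0 := by
  classical
  refine Submodule.span_induction (p := fun x _ => D.basis.repr x ⟨m, S, T⟩ = 0) ?_ ?_ ?_ ?_ hx
  · rintro x ⟨k, hk, U, V, rfl⟩
    rw [Module.Basis.repr_self, Finsupp.single_apply, if_neg]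
    intro h'
    obtain rfl : k = m := congrArg Sigma.fst h'
    exact h hk
  · simp
  · intro x y _ _ hx hy
    simp [hx, hy]
  · intro r x _ hx
    simp [hx]

/-- `C^m_{U,V}` acts as zero on `W(l)` unless `l ≤ m`. -/
theorem coeff_basis_of_not_le (D : CellDatum R A Λ M) {l m : Λ} (h : ¬ l ≤ m) (U V : M m)
    (S' S : M l) : D.coeff (D.basis ⟨m, U, V⟩) l S' S = 0 := by
  classical
  -- The product `C^m_{U,V} C^l_{S,S}` is read in two ways: as left multiplication it shows the
  -- wanted coefficient, as right multiplication it lies in the span of the `C^m_{U,V'}` plus `A(<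
  -- m)`.
  have h1 := D.repr_lower_of_not_lt (fun h' => h h'.le) S' S
    (D.basis_mul m U V (D.basis ⟨l, S, S⟩))
  have h2 : D.basis.repr (∑ V', D.coeff (D.inv (D.basis ⟨l, S, S⟩)) m V' V • D.basis ⟨m, U, V'⟩)
      ⟨l, S', S⟩ = 0 := by
    rw [map_sum, Finsupp.finsetSum_apply]
    refine Finset.sum_eq_zero fun V' _ => ?_
    rw [map_smul, Finsupp.smul_apply, Module.Basis.repr_self, Finsupp.single_apply, if_neg,
      smul_zero]
    intro h'
    exact h (congrArg Sigma.fst h').ge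
  rwa [map_sub, Finsupp.sub_apply, h2, sub_zero, D.repr_mul_basis] at h1

open Classical in
/-- `C_{U,V}` acts on its own cell module by `C_{U,V} C_S = Φ(V, S) C_U`. -/
theorem coeff_basis (D : CellDatum R A Λ M) (l : Λ) (U V S' S : M l) :
    D.coeff (D.basis ⟨l, U, V⟩) l S' S =
      if S' = U then D.coeff (D.basis ⟨l, S, S⟩) l S V else 0 := by
  -- The same double reading inside one cell: right multiplication fixes the first index `U`, which
  -- forces `S' = U`.
  have h1 := D.repr_lower l S' S (D.basis_mul l U V (D.basis ⟨l, S, S⟩))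
  rw [map_sub, Finsupp.sub_apply, sub_eq_zero, D.repr_mul_basis] at h1
  rw [h1, map_sum, Finsupp.finsetSum_apply, Finset.sum_eq_single S]
  · rw [D.inv_basis, map_smul, Finsupp.smul_apply, Module.Basis.repr_self, Finsupp.single_apply]
    by_cases h : S' = U
    · simp [h]
    · rw [if_neg h, if_neg, smul_zero]
      intro h'
      simp at h'
      exact h h'.symm
  · intro V' _ hV'
    rw [map_smul, Finsupp.smul_apply, Module.Basis.repr_self, Finsupp.single_apply, if_neg,
      smul_zero]
    intro h'
    simp at h'
    exact hV' h'.2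
  · simp

theorem toMatrix_repBaseChange_cellRep (K : Type*) [Field K] [Algebra R K] (D : CellDatum R A Λ M)
    (l : Λ) [DecidableEq (M l)] (a : A) :
    LinearMap.toMatrix ((Pi.basisFun R (M l)).baseChange K) ((Pi.basisFun R (M l)).baseChange K)
      (repBaseChange K (D.cellRep l) (1 ⊗ₜ[R] a)) =
      Matrix.of fun S' S => algebraMap R K (D.coeff a l S' S) := by
  ext S' S
  rw [LinearMap.toMatrix_apply, Module.Basis.baseChange_apply, repBaseChange_tmul]
  have h : D.cellRep l a (Pi.basisFun R (M l) S) S' = D.coeff a l S' S := by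
    have h1 := congrFun (D.cellRep_single l a S) S'
    simp only [Finset.sum_apply, Pi.smul_apply, Pi.single_apply, smul_eq_mul, mul_ite, mul_one,
      mul_zero, Finset.sum_ite_eq, Finset.mem_univ, if_true] at h1
    rw [← h1, Pi.basisFun_apply]
    congr!
  rw [Module.Basis.baseChange_repr_tmul, Pi.basisFun_repr, h, one_mul, Algebra.smul_def, mul_one,
    Matrix.of_apply]

/-! ### Matrix coefficients as traces, and their orthogonality. -/

variable [Fintype Λ] {τ : A →ₗ[R] R}

/-- Pairing with `D_{S',T}` extracts the coordinate at `C_{S',T}`. The index `T` is free, which lets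
it be matched with the `T` used in `x_λ`. -/
theorem coeff_eq_trace (D : CellDatum R A Λ M) (hτ : IsSymmetrizingTrace τ) (l : Λ)
    (S' S T : M l) (a : A) :
    D.coeff a l S' S =
      τ (a * (D.basis ⟨l, S, T⟩ * traceDualBasis τ D.basis ⟨l, S', T⟩)) := by
  rw [← mul_assoc, hτ.trace_mul_dualBasis, D.repr_mul_basis]

/-- The trace is a coefficient on `W(l)` of a product starting with `C^m`, which is zero unless `l ≤
m`. In that case cyclicity makes it a coefficient on `W(m)` of a product starting with `C^l`, which
is zero since `m ≤ l` fails. -/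
theorem trace_cross_of_ne (D : CellDatum R A Λ M) (hτ : IsSymmetrizingTrace τ) {l m : Λ}
    (h : l ≠ m) (P P' Q : M m) (S S' T : M l) :
    τ (D.basis ⟨m, P, Q⟩ * traceDualBasis τ D.basis ⟨m, P', Q⟩ *
      (D.basis ⟨l, S, T⟩ * traceDualBasis τ D.basis ⟨l, S', T⟩)) = 0 := by
  by_cases hlm : l ≤ m
  · have hml : ¬ m ≤ l := fun h' => h (hlm.antisymm h')
    rw [hτ.trace_mul_comm, ← D.coeff_eq_trace hτ, D.coeff_mul]
    exact Finset.sum_eq_zero fun X _ => by rw [D.coeff_basis_of_not_le hml, zero_mul]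
  · rw [← D.coeff_eq_trace hτ, D.coeff_mul]
    exact Finset.sum_eq_zero fun X _ => by rw [D.coeff_basis_of_not_le hlm, zero_mul]

/-- The scalar by which `C_{T,T} D_{T,T}` maps `C_T` to a multiple of itself in `W(l)`. -/
noncomputable def cellScalar (D : CellDatum R A Λ M) (τ : A →ₗ[R] R) (l : Λ) (T : M l) : R :=
  D.coeff (D.basis ⟨l, T, T⟩ * traceDualBasis τ D.basis ⟨l, T, T⟩) l T T

open Classical in
-- Since `C_{P,T}` maps `W(l)` into the line of `C_P`, the trace needs `P = S'` and is then
-- independent of `P`. Swapping the two factors under `τ` gives the same for `P'` and `S`, so all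
-- nonzero cases agree with the one where every index is `T`.
theorem trace_cross_self (D : CellDatum R A Λ M) (hτ : IsSymmetrizingTrace τ) (l : Λ)
    (P P' S S' T : M l) :
    τ (D.basis ⟨l, P, T⟩ * traceDualBasis τ D.basis ⟨l, P', T⟩ *
      (D.basis ⟨l, S, T⟩ * traceDualBasis τ D.basis ⟨l, S', T⟩)) =
      if P = S' ∧ P' = S then D.cellScalar τ l T else 0 := by
  let f : M l → M l → M l → M l → R := fun P P' S S' =>
    τ (D.basis ⟨l, P, T⟩ * traceDualBasis τ D.basis ⟨l, P', T⟩ *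
      (D.basis ⟨l, S, T⟩ * traceDualBasis τ D.basis ⟨l, S', T⟩))
  have hcomm : ∀ P P' S S', f P P' S S' = f S S' P P' := fun _ _ _ _ => hτ.trace_mul_comm _ _
  have hf : ∀ P P' S S', f P P' S S' = if S' = P then
      ∑ X, D.coeff (D.basis ⟨l, X, X⟩) l X T *
        D.coeff (traceDualBasis τ D.basis ⟨l, P', T⟩) l X S else 0 := by
    intro P P' S S'
    simp only [f]
    rw [← D.coeff_eq_trace hτ, D.coeff_mul]
    simp only [D.coeff_basis l P T]
    split_ifs <;> simp
  have hind : ∀ P Q P' S, f P P' S P = f Q P' S Q := by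
    intro P Q P' S
    rw [hf, hf, if_pos rfl, if_pos rfl]
  have hT : D.cellScalar τ l T = f T T T T := D.coeff_eq_trace hτ l T T T _
  change f P P' S S' = _
  split_ifs with h
  · obtain ⟨rfl, rfl⟩ := h
    rw [hind P T, hcomm, hind P' T, hT]
  · by_cases h1 : P = S'
    · rw [hcomm, hf, if_neg fun h2 => h ⟨h1, h2⟩]
    · rw [hf, if_neg (Ne.symm h1)]

open Classical in
-- Schur orthogonality for the cell module: the Casimir identity collapses the sum to a single
-- trace.
theorem sum_coeff_mul_coeff (D : CellDatum R A Λ M) (hτ : IsSymmetrizingTrace τ) (l : Λ)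
    (S' P Q S T : M l) :
    ∑ j, D.coeff (D.basis j) l S' P * D.coeff (traceDualBasis τ D.basis j) l Q S =
      if P = Q ∧ S' = S then D.cellScalar τ l T else 0 := by
  simp only [fun a S' S => D.coeff_eq_trace hτ l S' S T a]
  rw [hτ.sum_trace_mul_trace, D.trace_cross_self hτ]

/-! ### Characters of cell modules on the elements `x_λ`. -/

/-- The character of the cell module `W(l)`. -/
def cellChar (D : CellDatum R A Λ M) (l : Λ) : A →ₗ[R] R where
  toFun a := ∑ S, D.coeff a l S S
  map_add' a b := by simp only [D.coeff_add, Finset.sum_add_distrib]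
  map_smul' r a := by simp only [D.coeff_smul, Finset.mul_sum, RingHom.id_apply, smul_eq_mul]

theorem cellChar_xElem_of_ne (D : CellDatum R A Λ M) (hτ : IsSymmetrizingTrace τ) {l m : Λ}
    (h : l ≠ m) (T : M m) (T' : M l) : D.cellChar l (D.xElem τ m T) = 0 := by
  rw [xElem, map_sum]
  refine Finset.sum_eq_zero fun U _ => Finset.sum_eq_zero fun S _ => ?_
  -- Any `T'` in `M l` serves as the free index.
  rw [D.coeff_eq_trace hτ l S S T', D.trace_cross_of_ne hτ h]

/-- Each summand `C_{U,T} D_{U,T}` has a single diagonal entry that can be nonzero, at `U`, and it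
does not depend on `U`. -/
theorem cellChar_xElem_self (D : CellDatum R A Λ M) (hτ : IsSymmetrizingTrace τ) (l : Λ)
    (T : M l) : D.cellChar l (D.xElem τ l T) = D.cellScalar τ l T * Fintype.card (M l) := by
  classical
  rw [xElem, map_sum]
  have h : ∀ U : M l, D.cellChar l (D.basis ⟨l, U, T⟩ * traceDualBasis τ D.basis ⟨l, U, T⟩) =
      D.cellScalar τ l T := by
    intro U
    change ∑ S, D.coeff _ l S S = _
    simp only [fun S => D.coeff_eq_trace hτ l S S T, D.trace_cross_self hτ]
    simp
  simp [h, mul_comm]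

/-! ### Identification of the Schur element and the integrality statement. -/

variable (K : Type*) [Field K] [Algebra R K]

/-- In the standard basis of `W(l)` the defining identity of a Schur element is orthogonality of
matrix coefficients, weighted by the entries of `φ`. -/
theorem isCellSchurElement_cellScalar (D : CellDatum R A Λ M) (hτ : IsSymmetrizingTrace τ) (l : Λ)
    (T : M l) : D.IsCellSchurElement K τ l (algebraMap R K (D.cellScalar τ l T)) := by
  classical
  intro φ
  let e := (Pi.basisFun R (M l)).baseChange K
  apply (LinearMap.toMatrix e e).injective
  have hX : LinearMap.trace K _ φ = (LinearMap.toMatrix e e φ).trace :=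
    LinearMap.trace_eq_matrix_trace K e φ
  rw [hX]
  generalize hX' : LinearMap.toMatrix e e φ = X
  simp only [map_sum, LinearMap.toMatrix_mul, map_smul, LinearMap.toMatrix_one, hX',
    hτ.traceDualBasis_baseChange, Module.Basis.baseChange_apply, e,
    D.toMatrix_repBaseChange_cellRep K]
  ext S' S
  have key : ∀ P Q, ∑ j, algebraMap R K (D.coeff (D.basis j) l S' P) *
      algebraMap R K (D.coeff (traceDualBasis τ D.basis j) l Q S) =
      if P = Q ∧ S' = S then algebraMap R K (D.cellScalar τ l T) else 0 := by
    intro P Q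
    simp only [← map_mul, ← map_sum]
    rw [D.sum_coeff_mul_coeff hτ l S' P Q S T, apply_ite (algebraMap R K), map_zero]
  -- The sum over the basis of `A` is moved innermost, so that `key` leaves only `P = Q` and `S' =
  -- S`, that is, the trace of `X` on the diagonal.
  calc _ = ∑ Q, ∑ P, X P Q * ∑ j, algebraMap R K (D.coeff (D.basis j) l S' P) *
      algebraMap R K (D.coeff (traceDualBasis τ D.basis j) l Q S) := by
        simp only [Matrix.sum_apply, Matrix.mul_apply, Matrix.of_apply, Finset.sum_mul,
          Finset.mul_sum]
        rw [Finset.sum_comm]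
        refine Finset.sum_congr rfl fun Q _ => ?_
        rw [Finset.sum_comm]
        refine Finset.sum_congr rfl fun P _ => Finset.sum_congr rfl fun j _ => by ring
    _ = _ := by
        simp only [key]
        by_cases h : S' = S
        · simp [h, Matrix.trace, Finset.mul_sum, mul_comm]
        · simp [h]

theorem cellSchurElement_eq (D : CellDatum R A Λ M) (hτ : IsSymmetrizingTrace τ) (l : Λ)
    (T : M l) : D.cellSchurElement K τ l = algebraMap R K (D.cellScalar τ l T) := by
  have : Nonempty (M l) := ⟨T⟩
  let e := (Pi.basisFun R (M l)).baseChange K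
  have : Nontrivial (K ⊗[R] (M l → R)) := e.repr.toEquiv.nontrivial
  have : FiniteDimensional K (K ⊗[R] (M l → R)) := e.finiteDimensional_of_finite
  exact (D.isCellSchurElement_cellScalar K hτ l T).schurElement_eq

end CellDatum

theorem corollary4p3 {R A K Λ : Type*} [CommRing R] [IsDomain R] [Ring A] [Algebra R A]
    [Field K] [Algebra R K] [IsFractionRing R K]
    [PartialOrder Λ] [Fintype Λ] (M : Λ → Type*) [∀ l, Fintype (M l)]
    (D : CellDatum R A Λ M) (τ : A →ₗ[R] R) (hτ : IsSymmetrizingTrace τ)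
    (hss : IsSplitSemisimple K (K ⊗[R] A))
    (T : ∀ l, M l) (α : Λ → K) (a : A)
    (ha : (1 : K) ⊗ₜ[R] a = ∑ l, α l • ((1 : K) ⊗ₜ[R] D.xElem τ l (T l))) (l : Λ) :
    D.IsCellSchurElement K τ l (D.cellSchurElement K τ l) ∧
      ∃ r : R, algebraMap R K r =
        α l * D.cellSchurElement K τ l * (Fintype.card (M l) : K) := by
  rw [D.cellSchurElement_eq K hτ l (T l)]
  -- The witness in `R` is the character value of `a` itself.
  refine ⟨D.isCellSchurElement_cellScalar K hτ l (T l), D.cellChar l a, ?_⟩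
  have h := congrArg (traceBaseChange K (D.cellChar l)) ha
  rw [traceBaseChange_tmul, one_mul, map_sum] at h
  rw [h, Finset.sum_eq_single l]
  · rw [map_smul, traceBaseChange_tmul, one_mul, D.cellChar_xElem_self hτ, smul_eq_mul, map_mul,
      map_natCast, mul_assoc]
  · intro m _ hm
    rw [map_smul, traceBaseChange_tmul, D.cellChar_xElem_of_ne hτ hm.symm _ (T l), map_zero,
      mul_zero, smul_zero]
  · simp
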